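/- **Theorem (duality for the compounds of the matrix exponential).** Let $n$ and $k$ be integers with $1\le k\le n-1$, and let $r:=\binom{n}{k}=\binom{n}{n-k}$. For $1\le \ell\le n$, let $Q(\ell,n)$ be the set of strictly increasing sequences of $\ell$ integers from $\{1,\dots,n\}$, ordered lexicographically. For $M\in\mathbb{C}^{n\times n}$, let $M^{(\ell)}$ be its $\ell$-multiplicative compound: the $\binom{n}{\ell}\times\binom{n}{\ell}$ matrix whose $(i,j)$ entry is the minor of $M$ with rows indexed by the $i$-th and columns indexed by the $j$-th sequence of $Q(\ell,n)$. Write $Q(k,n)=(\alpha^1,\dots,\alpha^r)$ in lexicographic order, let $s(\alpha^j):=(-1)^{\alpha^j_1+\dots+\alpha^j_k}$, and let $U\in\{-1,0,1\}^{r\times r}$ be the anti-diagonal matrix with entries $$u_{ij}=\begin{cases} s(\alpha^j), & i+j=r+1,\\ 0, & \text{otherwise.}\end{cases}$$ Then for every $A\in\mathbb{C}^{n\times n}$, $$\big((\exp(A))^{(k)}\big)^T=\exp(\operatorname{tr}(A))\;U^T\,\big(\exp(-A)\big)^{(n-k)}\,U .$$ -/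

import Mathlib

noncomputable section

/-- `Q(k, n)`: the strictly increasing sequences of `k` elements of `Fin n`, with the
lexicographic order (inherited from the lexicographic order on `Fin k → Fin n`).
The element `a : Fin n` stands for the integer `a + 1` of `{1, …, n}`. -/
abbrev IncSeq (k n : ℕ) : Type :=
  {a : Lex (Fin k → Fin n) // StrictMono (ofLex a)}

instance IncSeq.instFintype (k n : ℕ) : Fintype (IncSeq k n) :=
  haveI : Finite (Lex (Fin k → Fin n)) := inferInstanceAs (Finite (Fin k → Fin n))
  Fintype.ofFinite _

theorem IncSeq.card (k n : ℕ) : Fintype.card (IncSeq k n) = n.choose k := by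
  let e : IncSeq k n ≃ (Fin k ↪o Fin n) :=
    { toFun := fun a => OrderEmbedding.ofStrictMono (ofLex a.1) a.2
      invFun := fun f => ⟨toLex f, f.strictMono⟩
      left_inv := fun a => rfl
      right_inv := fun f => by ext; rfl }
  have h := Nat.card_congr (e.trans Set.powersetCard.ofFinEmbEquiv)
  rw [Nat.card_eq_fintype_card, Set.powersetCard.card, Nat.card_fin] at h
  exact h

/-- The lexicographic enumeration `α¹ < α² < ⋯ < αʳ`, `r = n.choose k`, of `Q(k, n)`. -/
def lexSeq (k n : ℕ) : Fin (n.choose k) ≃o IncSeq k n :=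
  monoEquivOfFin (IncSeq k n) (IncSeq.card k n)

/-- The `j`-th sequence of `Q(k, n)` in the lexicographic order, as a function. -/
def seqAt (k n : ℕ) (j : Fin (n.choose k)) : Fin k → Fin n :=
  ofLex (lexSeq k n j).1

/-- The `k`-multiplicative compound `A^{(k)}`: the matrix of all `k`-minors of `A`, rows and
columns ordered lexicographically. -/
def mulCompound {n m : ℕ} (k : ℕ) (A : Matrix (Fin n) (Fin m) ℂ) :
    Matrix (Fin (n.choose k)) (Fin (m.choose k)) ℂ :=
  Matrix.of fun i j => (A.submatrix (seqAt k n i) (seqAt k m j)).det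

/-- The signature `(-1) ^ (α₁ + ⋯ + αₖ)` of a sequence with entries in `{1, …, n}`
(the entry `a : Fin n` stands for `a + 1`). -/
def signature {k n : ℕ} (a : Fin k → Fin n) : ℂ :=
  (-1) ^ ∑ l, ((a l : ℕ) + 1)

/-- The anti-diagonal matrix `U(k, n)`, whose entry in column `j` of the anti-diagonal is the
signature of the `j`-th sequence. With one-based indices the anti-diagonal is `i + j = r + 1`;
`i` and `j` below are zero-based. -/
def antiDiagU (k n : ℕ) : Matrix (Fin (n.choose k)) (Fin (n.choose k)) ℂ :=
  Matrix.of fun i j => if (i : ℕ) + 1 + (j + 1) = n.choose k + 1 then signature (seqAt k n j) else 0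

end

/-! `exp A` and `exp (-A)` are mutually inverse and `det (exp A) = exp (tr A)` (`Matrix.det_exp`),
so the theorem is Jacobi's formula: if `M * N = 1`, a `k`-minor of `M` is, up to sign, `det M` times
the complementary minor of `N` with rows and columns exchanged. A block computation
(`Matrix.det_submatrix_inl_eq`) gives this with the signs of the shuffles that bring the chosen rows
and columns to the front; counting inversions (`IncSeq.sign_shuffle`) turns them into signatures.
Complementation reverses the lexicographic order (`lexSeq_rev`), whence the anti-diagonal shape of
`U`. -/

open Matrix

/-! ### Determinant of the matrix exponential. -/

section DetExp

variable {ι : Type*} [Fintype ι] [DecidableEq ι]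

open scoped Matrix.Norms.Operator in
theorem Matrix.differentiable_det : Differentiable ℂ (det : Matrix ι ι ℂ → ℂ) := by
  have entry (i j : ι) : Differentiable ℂ fun M : Matrix ι ι ℂ => M i j :=
    (LinearMap.toContinuousLinearMap (entryLinearMap ℂ ℂ i j)).differentiable
  have : (det : Matrix ι ι ℂ → ℂ) =
      fun M => ∑ σ : Equiv.Perm ι, ((Equiv.Perm.sign σ : ℤ) : ℂ) * ∏ i, M (σ i) i :=
    funext det_apply'
  rw [this]
  fun_prop

-- Along the line `1 + t • A` the determinant is a polynomial in `t` whose linear coefficient is the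
-- trace.
open scoped Matrix.Norms.Operator in
theorem Matrix.fderiv_det_one_apply (A : Matrix ι ι ℂ) :
    fderiv ℂ (det : Matrix ι ι ℂ → ℂ) 1 A = A.trace := by
  have h1 : HasDerivAt (fun t : ℂ => 1 + t • A) A 0 := by
    have h := ((hasDerivAt_id (0 : ℂ)).smul_const A).const_add (1 : Matrix ι ι ℂ)
    rwa [one_smul] at h
  have h2 : HasDerivAt (fun t : ℂ => det (1 + t • A)) (fderiv ℂ det (1 : Matrix ι ι ℂ) A) 0 := by
    refine HasFDerivAt.comp_hasDerivAt_of_eq 0 (differentiable_det 1).hasFDerivAt h1 ?_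
    simp
  let p := det (1 + (Polynomial.X : Polynomial ℂ) • A.map Polynomial.C)
  have h3 : (fun t : ℂ => det (1 + t • A)) = fun t => p.eval t := by
    funext t
    simp [p, eval_det, ← smul_eq_mul_diagonal]
  rw [h3] at h2
  rw [h2.unique (p.hasDerivAt 0), derivative_det_one_add_X_smul]

-- Factoring out `exp (t • A)` reduces the derivative at `t` to the one at `0`.
open scoped Matrix.Norms.Operator in
theorem Matrix.hasDerivAt_det_exp_smul (A : Matrix ι ι ℂ) (t : ℂ) :
    HasDerivAt (fun u : ℂ => (NormedSpace.exp (u • A)).det)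
      ((NormedSpace.exp (t • A)).det * A.trace) t := by
  have h0 : HasDerivAt (fun u : ℂ => (NormedSpace.exp (u • A)).det) A.trace 0 := by
    rw [← fderiv_det_one_apply A]
    have h1 := hasDerivAt_exp_smul_const (𝕂 := ℂ) A 0
    rw [zero_smul, NormedSpace.exp_zero, one_mul] at h1
    refine HasFDerivAt.comp_hasDerivAt_of_eq 0 (differentiable_det 1).hasFDerivAt h1 ?_
    simp
  have h1 : (fun u : ℂ => (NormedSpace.exp (u • A)).det) =
      fun u => (NormedSpace.exp (t • A)).det * (NormedSpace.exp ((u - t) • A)).det := by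
    funext u
    rw [← det_mul, ← Matrix.exp_add_of_commute _ _
      (((Commute.refl A).smul_left t).smul_right (u - t)), ← add_smul]
    simp
  rw [h1]
  refine HasDerivAt.const_mul _ ?_
  refine HasDerivAt.comp_sub_const (f := fun u : ℂ => (NormedSpace.exp (u • A)).det) t t ?_
  simpa using h0

/-- The determinant of the exponential is the exponential of the trace. -/
theorem Matrix.det_exp (A : Matrix ι ι ℂ) :
    (NormedSpace.exp A).det = Complex.exp A.trace := by
  let g : ℂ → ℂ := fun u => (NormedSpace.exp (u • A)).det * Complex.exp (-(u * A.trace))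
  have hg (t : ℂ) : HasDerivAt g 0 t := by
    have h1 : HasDerivAt (fun u : ℂ => -(u * A.trace)) (-A.trace) t := by
      have h := ((hasDerivAt_id t).mul_const A.trace).fun_neg
      rwa [one_mul] at h
    refine ((hasDerivAt_det_exp_smul A t).mul h1.cexp).congr_deriv ?_
    ring
  have hc : g 1 = g 0 :=
    is_const_of_deriv_eq_zero (fun t => (hg t).differentiableAt) (fun t => (hg t).deriv) 1 0
  have h2 : (NormedSpace.exp A).det * Complex.exp (-A.trace) = 1 := by simpa [g] using hc
  rw [Complex.exp_neg] at h2
  exact (mul_inv_eq_one₀ (Complex.exp_ne_zero _)).1 h2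

end DetExp

/-! ### Complementary minors of inverse matrices. -/

/-- **Jacobi's complementary minor formula** in block form. -/
theorem Matrix.det_submatrix_inl_eq {R n κ μ : Type*} [CommRing R] [Fintype n] [DecidableEq n]
    [Fintype κ] [DecidableEq κ] [Fintype μ] [DecidableEq μ] {M N : Matrix n n R} (h : M * N = 1)
    (e f : κ ⊕ μ ≃ n) :
    (M.submatrix (e ∘ Sum.inl) (f ∘ Sum.inl)).det =
      (M.submatrix e f).det * (N.submatrix (f ∘ Sum.inr) (e ∘ Sum.inr)).det := by
  let P := M.submatrix e f
  let Q := N.submatrix f e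
  have hPQ : P * Q = 1 := by
    rw [submatrix_mul_equiv, h, submatrix_one_equiv]
  rw [← fromBlocks_toBlocks P, ← fromBlocks_toBlocks Q, fromBlocks_multiply,
    ← fromBlocks_one, fromBlocks_inj] at hPQ
  obtain ⟨-, h12, -, h22⟩ := hPQ
  -- The second block column of `Q` is kept, so `P` sends it to that of the identity; both block
  -- triangular determinants are then single minors.
  have hmul : P * fromBlocks 1 Q.toBlocks₁₂ 0 Q.toBlocks₂₂ =
      fromBlocks P.toBlocks₁₁ 0 P.toBlocks₂₁ 1 := by
    conv_lhs => rw [← fromBlocks_toBlocks P]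
    rw [fromBlocks_multiply, h12, h22]
    simp
  have hdet := congrArg det hmul
  rw [det_mul, det_fromBlocks_zero₂₁, det_fromBlocks_zero₁₂, det_one, det_one, one_mul,
    mul_one] at hdet
  exact hdet.symm

theorem Matrix.det_submatrix_perm_perm {R n : Type*} [CommRing R] [Fintype n] [DecidableEq n]
    (M : Matrix n n R) (σ τ : Equiv.Perm n) :
    (M.submatrix σ τ).det =
      ((Equiv.Perm.sign σ : ℤ) : R) * ((Equiv.Perm.sign τ : ℤ) : R) * M.det := by
  have : M.submatrix σ τ = (M.submatrix id τ).submatrix σ id := rfl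
  rw [this, det_permute, det_permute', mul_assoc]

/-! ### Complementary sequences and signs of shuffles. -/

namespace IncSeq

variable {k m n : ℕ}

theorem lt_iff {a b : IncSeq k n} :
    a < b ↔ ∃ i, (∀ j < i, ofLex a.1 j = ofLex b.1 j) ∧ ofLex a.1 i < ofLex b.1 i :=
  Iff.rfl

/-- In terms of sets, the smaller sequence is the one that owns the least element of the symmetric
difference. -/
theorem exists_mem_range_of_lt {a b : IncSeq k n} (h : a < b) :
    ∃ x ∈ Set.range (ofLex a.1), x ∉ Set.range (ofLex b.1) ∧
      ∀ y < x, y ∈ Set.range (ofLex a.1) ↔ y ∈ Set.range (ofLex b.1) := by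
  obtain ⟨i, hlt, hi⟩ := lt_iff.1 h
  refine ⟨ofLex a.1 i, ⟨i, rfl⟩, ?_, fun y hy => ⟨?_, ?_⟩⟩
  · rintro ⟨j, hj⟩
    rcases lt_or_ge j i with hji | hij
    · exact (a.2 hji).ne ((hlt j hji).trans hj)
    · exact (hi.trans_le (b.2.monotone hij)).ne' hj
  · rintro ⟨j, rfl⟩
    exact ⟨j, (hlt j (a.2.lt_iff_lt.1 hy)).symm⟩
  · rintro ⟨j, rfl⟩
    exact ⟨j, hlt j (b.2.lt_iff_lt.1 (hy.trans hi))⟩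

theorem lt_of_mem_range {a b : IncSeq k n} {x : Fin n} (hxa : x ∈ Set.range (ofLex a.1))
    (hxb : x ∉ Set.range (ofLex b.1))
    (h : ∀ y < x, y ∈ Set.range (ofLex a.1) ↔ y ∈ Set.range (ofLex b.1)) : a < b := by
  rcases lt_trichotomy a b with hab | rfl | hba
  · exact hab
  · exact absurd hxa hxb
  · obtain ⟨y, hyb, hya, hy⟩ := exists_mem_range_of_lt hba
    rcases lt_trichotomy x y with hxy | rfl | hyx
    · exact absurd ((hy x hxy).2 hxa) hxb
    · exact absurd hyb hxb
    · exact absurd ((h y hyx).2 hyb) hya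

/-- The elements of a sequence, as a finite set. -/
def toFinset (a : IncSeq k n) : Finset (Fin n) :=
  Finset.univ.map ⟨ofLex a.1, a.2.injective⟩

theorem card_toFinset (a : IncSeq k n) : a.toFinset.card = k := by
  simp [toFinset]

theorem card_compl_toFinset (a : IncSeq k (k + m)) : a.toFinsetᶜ.card = m := by
  simp [Finset.card_compl, card_toFinset]

/-- The elements of an increasing sequence, followed by the other elements in increasing order. -/
def splitEquiv (a : IncSeq k (k + m)) : Fin k ⊕ Fin m ≃ Fin (k + m) :=
  finSumEquivOfFinset a.card_toFinset a.card_compl_toFinset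

theorem splitEquiv_inl (a : IncSeq k (k + m)) (i : Fin k) :
    a.splitEquiv (Sum.inl i) = ofLex a.1 i := by
  have := Finset.orderEmbOfFin_unique a.card_toFinset (f := ofLex a.1)
    (fun i => by simp [toFinset, -Pi.ofLex_apply]) a.2
  rw [splitEquiv, finSumEquivOfFinset_inl, this]

/-- The complementary increasing sequence. -/
def compl (a : IncSeq k (k + m)) : IncSeq m (k + m) :=
  ⟨toLex fun j => a.splitEquiv (Sum.inr j),
    (a.toFinsetᶜ.orderEmbOfFin a.card_compl_toFinset).strictMono⟩

theorem splitEquiv_inr (a : IncSeq k (k + m)) (j : Fin m) :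
    a.splitEquiv (Sum.inr j) = ofLex a.compl.1 j :=
  rfl

theorem mem_range_compl (a : IncSeq k (k + m)) (x : Fin (k + m)) :
    x ∈ Set.range (ofLex a.compl.1) ↔ x ∉ Set.range (ofLex a.1) := by
  obtain ⟨y | y, rfl⟩ := a.splitEquiv.surjective x
  · simp [← splitEquiv_inr, ← splitEquiv_inl, -Pi.ofLex_apply]
  · simp [← splitEquiv_inr, ← splitEquiv_inl, -Pi.ofLex_apply]

/-- Complementing both sets keeps their symmetric difference but swaps the owner of its least
element. -/
theorem compl_strictAnti : StrictAnti (compl : IncSeq k (k + m) → IncSeq m (k + m)) := by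
  intro a b hab
  obtain ⟨x, hxa, hxb, h⟩ := exists_mem_range_of_lt hab
  refine lt_of_mem_range (x := x) ((mem_range_compl b x).2 hxb)
    (fun hx => (mem_range_compl a x).1 hx hxa) fun y hy => ?_
  rw [mem_range_compl, mem_range_compl, h y hy]

/-- The permutation that lists the elements of `a` and then the other elements. -/
def shuffle (a : IncSeq k (k + m)) : Equiv.Perm (Fin (k + m)) :=
  finSumFinEquiv.symm.trans a.splitEquiv

theorem shuffle_castAdd (a : IncSeq k (k + m)) (i : Fin k) :
    a.shuffle (Fin.castAdd m i) = ofLex a.1 i := by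
  simp [shuffle, splitEquiv_inl]

theorem shuffle_natAdd (a : IncSeq k (k + m)) (j : Fin m) :
    a.shuffle (Fin.natAdd k j) = ofLex a.compl.1 j := by
  simp [shuffle, splitEquiv_inr]

/-- Among the elements below the `i`-th entry (zero-based), exactly `i` lie in the sequence and the
others in its complement. -/
theorem card_compl_lt_add (a : IncSeq k (k + m)) (i : Fin k) :
    (Finset.univ.filter fun j => ofLex a.compl.1 j < ofLex a.1 i).card + i = ofLex a.1 i := by
  have h := Fin.card_Iio (ofLex a.1 i)
  have h1 : (Finset.univ.filter fun i' => ofLex a.1 i' < ofLex a.1 i) = Finset.Iio i := by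
    ext i'
    simp [a.2.lt_iff_lt, -Pi.ofLex_apply]
  have h2 : Finset.Iio (ofLex a.1 i) = Finset.univ.filter fun x => x < ofLex a.1 i := by
    ext; simp [-Pi.ofLex_apply]
  rw [h2, Finset.card_filter, ← a.splitEquiv.sum_comp, Fintype.sum_sum_type] at h
  rw [← Finset.card_filter, ← Finset.card_filter] at h
  simp only [splitEquiv_inl] at h
  rw [h1, Fin.card_Iio, add_comm] at h
  exact h

/-- Both blocks are listed increasingly, so inversions occur only between them. -/
theorem sign_shuffle_eq_prod (a : IncSeq k (k + m)) :
    Equiv.Perm.sign a.shuffle =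
      ∏ i : Fin k, ∏ j : Fin m, if ofLex a.1 i < ofLex a.compl.1 j then 1 else -1 := by
  have hI (i : Fin (k + m)) (f : Fin (k + m) → ℤˣ) :
      ∏ j ∈ Finset.Ioi i, f j = ∏ j, if i < j then f j else 1 := by
    rw [← Finset.prod_filter]
    congr 1
    ext; simp
  rw [Equiv.Perm.sign_eq_prod_prod_Ioi]
  simp only [hI, Fin.prod_univ_add, shuffle_castAdd, shuffle_natAdd, a.2.lt_iff_lt,
    a.compl.2.lt_iff_lt]
  have h1 (i i' : Fin k) : (if Fin.castAdd m i < Fin.castAdd m i' then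
      (if i < i' then (1 : ℤˣ) else -1) else 1) = 1 := by
    simp only [(Fin.strictMono_castAdd m).lt_iff_lt]
    split_ifs <;> rfl
  have h2 (i : Fin k) (j : Fin m) : Fin.castAdd m i < Fin.natAdd k j := by
    simp only [Fin.lt_def, Fin.val_castAdd, Fin.val_natAdd]; omega
  have h3 (j j' : Fin m) : (if Fin.natAdd k j < Fin.natAdd k j' then
      (if j < j' then (1 : ℤˣ) else -1) else 1) = 1 := by
    simp only [(Fin.strictMono_natAdd k).lt_iff_lt]
    split_ifs <;> rfl
  have h4 (i : Fin k) (j : Fin m) : ¬ Fin.natAdd k j < Fin.castAdd m i := (h2 i j).not_gt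
  simp only [h1, h2, h3, h4, if_true, if_false, Finset.prod_const_one, one_mul, mul_one]

theorem sign_shuffle (a : IncSeq k (k + m)) :
    Equiv.Perm.sign a.shuffle * (-1) ^ ∑ i : Fin k, (i : ℕ) = (-1) ^ ∑ i, (ofLex a.1 i : ℕ) := by
  rw [sign_shuffle_eq_prod, ← Finset.prod_pow_eq_pow_sum, ← Finset.prod_pow_eq_pow_sum,
    ← Finset.prod_mul_distrib]
  refine Finset.prod_congr rfl fun i _ => ?_
  have hne (j : Fin m) : ofLex a.compl.1 j ≠ ofLex a.1 i := fun h =>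
    (mem_range_compl a _).1 ⟨j, rfl⟩ ⟨i, h.symm⟩
  rw [Finset.prod_ite, Finset.prod_const_one, one_mul, Finset.prod_const, ← pow_add]
  rw [← card_compl_lt_add a i]
  congr 4
  ext j
  simpa using ⟨fun h => h.lt_of_ne (hne j), le_of_lt⟩

theorem sign_shuffle_mul_sign_shuffle (a b : IncSeq k (k + m)) :
    ((Equiv.Perm.sign a.shuffle : ℤ) : ℂ) * ((Equiv.Perm.sign b.shuffle : ℤ) : ℂ) =
      signature (ofLex a.1) * signature (ofLex b.1) := by
  have hsign (c : IncSeq k (k + m)) : signature (ofLex c.1) =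
      ((Equiv.Perm.sign c.shuffle : ℤ) : ℂ) * ((-1) ^ (∑ i : Fin k, (i : ℕ)) * (-1) ^ k) := by
    have h := congrArg (fun u : ℤˣ => ((u : ℤ) : ℂ)) c.sign_shuffle
    push_cast at h
    rw [signature, Finset.sum_add_distrib, pow_add, ← mul_assoc]
    rw [← h]
    simp
  have hsq (p q : ℕ) : ((-1 : ℂ) ^ p * (-1) ^ q) * ((-1) ^ p * (-1) ^ q) = 1 := by
    rw [← pow_add, ← mul_pow]; simp
  -- The discrepancy between signature and sign does not depend on the sequence and squares to `1`.
  rw [hsign a, hsign b, mul_mul_mul_comm, hsq, mul_one]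

end IncSeq

/-! ### Reversed enumeration and the matrix identity. -/

theorem lexSeq_rev (k m : ℕ) (h : (k + m).choose m = (k + m).choose k)
    (i : Fin ((k + m).choose k)) :
    lexSeq m (k + m) (Fin.cast h.symm i.rev) = (lexSeq k (k + m) i).compl := by
  have hsurj : Function.Surjective (IncSeq.compl : IncSeq k (k + m) → IncSeq m (k + m)) := by
    refine ((Fintype.bijective_iff_injective_and_card _).2
      ⟨IncSeq.compl_strictAnti.injective, ?_⟩).2
    rw [IncSeq.card, IncSeq.card, h]
  let f : Fin ((k + m).choose k) ≃o IncSeq m (k + m) :=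
    StrictMono.orderIsoOfSurjective (fun j => (lexSeq k (k + m) j.rev).compl)
      (fun j j' hj => IncSeq.compl_strictAnti ((lexSeq k (k + m)).strictMono (Fin.rev_lt_rev.2 hj)))
      (hsurj.comp ((lexSeq k (k + m)).surjective.comp Fin.rev_surjective))
  -- A finite linear order has only one increasing enumeration.
  have : (Fin.castOrderIso h.symm).trans (lexSeq m (k + m)) = f := Subsingleton.elim _ _
  have h2 := DFunLike.congr_fun this i.rev
  have h3 : f i.rev = (lexSeq k (k + m) i.rev.rev).compl := rfl
  rw [h3, Fin.rev_rev] at h2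
  exact h2

/-- **Jacobi's formula** relating the minors of mutually inverse matrices. -/
theorem mulCompound_apply_of_mul_eq_one {k m : ℕ} (h : (k + m).choose m = (k + m).choose k)
    {M N : Matrix (Fin (k + m)) (Fin (k + m)) ℂ} (hMN : M * N = 1)
    (i j : Fin ((k + m).choose k)) :
    mulCompound k M i j = M.det * (signature (seqAt k (k + m) j) *
      mulCompound m N (Fin.cast h.symm j.rev) (Fin.cast h.symm i.rev) *
        signature (seqAt k (k + m) i)) := by
  set a := lexSeq k (k + m) i with ha
  set b := lexSeq k (k + m) j with hb
  have hseq (l : Fin ((k + m).choose k)) :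
      seqAt k (k + m) l = (lexSeq k (k + m) l).splitEquiv ∘ Sum.inl :=
    funext fun x => (IncSeq.splitEquiv_inl _ x).symm
  have hcompl (l : Fin ((k + m).choose k)) : seqAt m (k + m) (Fin.cast h.symm l.rev) =
      (lexSeq k (k + m) l).splitEquiv ∘ Sum.inr := by
    rw [seqAt, lexSeq_rev k m h]; rfl
  have hdet : (M.submatrix a.splitEquiv b.splitEquiv).det =
      signature (ofLex a.1) * signature (ofLex b.1) * M.det := by
    rw [← IncSeq.sign_shuffle_mul_sign_shuffle, ← det_submatrix_perm_perm,
      ← det_submatrix_equiv_self finSumFinEquiv (M.submatrix a.shuffle b.shuffle)]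
    congr 1
    ext x y
    simp [IncSeq.shuffle]
  rw [mulCompound, mulCompound, of_apply, of_apply, hcompl, hcompl, hseq, hseq, ← ha, ← hb,
    det_submatrix_inl_eq hMN a.splitEquiv b.splitEquiv, hdet]
  simp only [Function.comp_def, IncSeq.splitEquiv_inl]
  ring

theorem antiDiagU_apply (k n : ℕ) (i j : Fin (n.choose k)) :
    antiDiagU k n i j = if i = j.rev then signature (seqAt k n j) else 0 := by
  rw [antiDiagU, of_apply]
  congr 1
  rw [Fin.ext_iff, Fin.val_rev, eq_iff_iff]
  omega

theorem antiDiagU_transpose_mul_mul_apply (k n : ℕ)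
    (B : Matrix (Fin (n.choose k)) (Fin (n.choose k)) ℂ) (i j : Fin (n.choose k)) :
    ((antiDiagU k n).transpose * B * antiDiagU k n) i j =
      signature (seqAt k n i) * B i.rev j.rev * signature (seqAt k n j) := by
  simp [mul_apply, antiDiagU_apply]

theorem mulCompound_transpose_of_mul_eq_one {n k m : ℕ} (hn : n = k + m)
    (h : n.choose m = n.choose k) {M N : Matrix (Fin n) (Fin n) ℂ} (hMN : M * N = 1) :
    (mulCompound k M).transpose =
      M.det • ((antiDiagU k n).transpose *
        Matrix.reindex (finCongr h) (finCongr h) (mulCompound m N) * antiDiagU k n) := by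
  subst hn
  ext i j
  rw [transpose_apply, Matrix.smul_apply, antiDiagU_transpose_mul_mul_apply,
    mulCompound_apply_of_mul_eq_one h hMN]
  rfl

theorem mainTheorem6 (n k : ℕ) (hk : 1 ≤ k) (hkn : k < n) (A : Matrix (Fin n) (Fin n) ℂ) :
    (mulCompound k (NormedSpace.exp A)).transpose =
      Complex.exp A.trace •
        ((antiDiagU k n).transpose *
          Matrix.reindex (finCongr (Nat.choose_symm hkn.le)) (finCongr (Nat.choose_symm hkn.le))
            (mulCompound (n - k) (NormedSpace.exp (-A))) *
          antiDiagU k n) := by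
  rw [← Matrix.det_exp]
  refine mulCompound_transpose_of_mul_eq_one (by omega) _ ?_
  rw [← Matrix.exp_add_of_commute _ _ (Commute.refl A).neg_right, add_neg_cancel,
    NormedSpace.exp_zero]
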